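/- A *hemiring* is an algebra $(R,+,\cdot,0)$ such that $(R,+,0)$ is a commutative monoid, $(R,\cdot)$ is a semigroup, multiplication distributes over addition on both sides, and $0r=0=r0$ for all $r\in R$. A *semiring* is a hemiring having a multiplicative identity. Hemiring homomorphisms preserve $+$, $\cdot$ and $0$; ideals are two-sided. A hemiring is *lattice-ordered* if it carries a lattice structure $(R,\vee,\wedge)$ such that $a+b=a\vee b$ and $ab\le a\wedge b$ for all $a,b\in R$. A hemiring is *ideal-simple* if $\{0\}$ and the whole hemiring are its only ideals, *congruence-simple* if the diagonal and the universal relation are its only congruences, and *simple* if it is both. The *Brown–McCoy radical class* consists of the hemirings no nonzero homomorphic image of which is an ideal-simple semiring, and the *Brown–McCoy radical* $\mathcal{R}_{BM}(R)$ is the union of all ideals of $R$ that, as hemirings, belong to this class. Let $\mathfrak{C}_s$ be the set of all congruences $\rho$ on $R$ such that $R/\rho$ is a nonzero simple semiring, and let $\mathcal{R}_{\mathfrak{C}_s}(R)=\bigcap_{\rho\in\mathfrak{C}_s}\{r\in R : (r,0)\in\rho\}$ (which is $R$ if $\mathfrak{C}_s=\emptyset$). A *subdirect product* of a family $(R_i)_{i\in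 I}$ of hemirings is a subhemiring of $\prod_{i\in I}R_i$ that projects onto every $R_i$. A hemiring $R$ is *semiisomorphic* to a hemiring $T$ if there is a surjective hemiring homomorphism $f:R\to T$ with $f^{-1}(0)=\{0\}$. The *Boolean semifield* is $\mathbf{B}=\{0,1\}$ with $1+1=1$. **Corollary 3.17.** For a lattice-ordered hemiring $R$, the following conditions are equivalent: (i) $\mathcal{R}_{BM}(R)=0$; (ii) $\mathcal{R}_{\mathfrak{C}_s}(R)=0$; (iii) $R$ is semiisomorphic to a subdirect product of nonzero simple lattice-ordered semirings; (iv) $R$ is semiisomorphic to a subdirect product of copies of the Boolean semifield $\mathbf{B}$. -/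

import Mathlib

/-! Hemirings are modelled by `NonUnitalSemiring`: a commutative additive monoid with an associative
multiplication that distributes over addition and satisfies `0 * r = 0 = r * 0`; no identity is
required. Hemiring homomorphisms are `R →ₙ+* S`, and subhemirings are `NonUnitalSubsemiring R`. -/

universe u v w

namespace Hemiring

/-- A hemiring is a semiring if its multiplicative semigroup has an identity element. -/
def HasIdentity (R : Type u) [NonUnitalSemiring R] : Prop :=
  ∃ e : R, ∀ x : R, e * x = x ∧ x * e = x

/-- A hemiring is lattice-ordered if it carries a lattice structure with `a + b = a ⊔ b` and
`a * b ≤ a ⊓ b` for the order of the lattice. -/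
def IsLatticeOrdered (R : Type u) [NonUnitalSemiring R] : Prop :=
  ∃ _ : Lattice R, ∀ a b : R, a + b = a ⊔ b ∧ a * b ≤ a ⊓ b

/-- Two-sided ideals of a hemiring. An ideal is in particular a subhemiring, so that it can be
regarded as a hemiring itself. -/
def IsIdeal {R : Type u} [NonUnitalSemiring R] (I : NonUnitalSubsemiring R) : Prop :=
  ∀ r : R, ∀ a ∈ I, r * a ∈ I ∧ a * r ∈ I

/-- The zero ideal and the whole hemiring are the only ideals. -/
def IsIdealSimple (R : Type u) [NonUnitalSemiring R] : Prop :=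
  ∀ I : NonUnitalSubsemiring R, IsIdeal I → I = ⊥ ∨ I = ⊤

/-- The diagonal and the universal congruence are the only congruences. -/
def IsCongruenceSimple (R : Type u) [NonUnitalSemiring R] : Prop :=
  ∀ c : RingCon R, c = ⊥ ∨ c = ⊤

/-- A hemiring is simple if it is both ideal-simple and congruence-simple. -/
def IsSimple (R : Type u) [NonUnitalSemiring R] : Prop :=
  IsIdealSimple R ∧ IsCongruenceSimple R

/-- Membership in the Brown-McCoy radical class: no nonzero homomorphic image of `R` is an
ideal-simple semiring. -/
def IsBrownMcCoyRadical (R : Type u) [NonUnitalSemiring R] : Prop :=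
  ∀ (S : Type u) [NonUnitalSemiring S] [Nontrivial S] (f : R →ₙ+* S),
    Function.Surjective f → ¬ (HasIdentity S ∧ IsIdealSimple S)

/-- The Brown-McCoy radical of `R`: the union of all ideals of `R` which, as hemirings, belong to
the Brown-McCoy radical class. -/
def brownMcCoyRadical (R : Type u) [NonUnitalSemiring R] : Set R :=
  ⋃ I ∈ {I : NonUnitalSubsemiring R | IsIdeal I ∧ IsBrownMcCoyRadical I}, (I : Set R)

/-- The congruences `ρ` on `R` such that `R / ρ` is a nonzero simple semiring. -/
def simpleCongruences (R : Type u) [NonUnitalSemiring R] : Set (RingCon R) :=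
  {ρ | Nontrivial ρ.Quotient ∧ HasIdentity ρ.Quotient ∧ IsSimple ρ.Quotient}

/-- The intersection of the kernels `{r | (r, 0) ∈ ρ}` of the congruences `ρ` on `R` such that
`R / ρ` is a nonzero simple semiring (all of `R` if there are none). -/
def simpleCongruenceRadical (R : Type u) [NonUnitalSemiring R] : Set R :=
  ⋂ ρ ∈ simpleCongruences R, {r : R | ρ r 0}

/-- A semiisomorphism is a surjective hemiring homomorphism with zero kernel; it need not be
injective. -/
def IsSemiisomorphism {R : Type u} {S : Type v} [NonUnitalSemiring R] [NonUnitalSemiring S]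
    (f : R →ₙ+* S) : Prop :=
  Function.Surjective f ∧ {a : R | f a = 0} = {0}

/-- A subhemiring of a direct product that projects onto every factor. -/
def IsSubdirectProduct {ι : Type v} {S : ι → Type w} [∀ i, NonUnitalSemiring (S i)]
    (T : NonUnitalSubsemiring (∀ i, S i)) : Prop :=
  ∀ i, Function.Surjective (fun t : T => (t : ∀ j, S j) i)

/-- `R` is semiisomorphic to a subdirect product of the family `S`. -/
def SemiisomorphicToSubdirectProduct (R : Type u) [NonUnitalSemiring R] {ι : Type v}
    (S : ι → Type w) [∀ i, NonUnitalSemiring (S i)] : Prop :=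
  ∃ T : NonUnitalSubsemiring (∀ i, S i), IsSubdirectProduct T ∧
    ∃ f : R →ₙ+* T, IsSemiisomorphism f

/-- The Boolean semifield `{0, 1}`, in which `1 + 1 = 1`. -/
inductive BooleanSemifield : Type
  | zero : BooleanSemifield
  | one : BooleanSemifield

namespace BooleanSemifield

instance : Zero BooleanSemifield := ⟨zero⟩

instance : One BooleanSemifield := ⟨one⟩

instance : Add BooleanSemifield :=
  ⟨fun a b => match a with
    | zero => b
    | one => one⟩

instance : Mul BooleanSemifield :=
  ⟨fun a b => match a with
    | zero => zero
    | one => b⟩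

instance : Inv BooleanSemifield := ⟨fun a => a⟩

instance : Semifield BooleanSemifield where
  add_assoc a b c := by cases a <;> rfl
  zero_add a := rfl
  add_zero a := by cases a <;> rfl
  add_comm a b := by cases a <;> cases b <;> rfl
  mul_assoc a b c := by cases a <;> rfl
  one_mul a := rfl
  mul_one a := by cases a <;> rfl
  zero_mul a := rfl
  mul_zero a := by cases a <;> rfl
  left_distrib a b c := by cases a <;> rfl
  right_distrib a b c := by cases a <;> cases b <;> cases c <;> rfl
  mul_comm a b := by cases a <;> cases b <;> rfl
  nsmul := nsmulRec
  exists_pair_ne := ⟨zero, one, fun h => by cases h⟩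
  inv_zero := rfl
  mul_inv_cancel a ha := by
    cases a
    · exact absurd rfl ha
    · rfl
  nnqsmul := _
  nnqsmul_def _ _ := rfl

end BooleanSemifield

end Hemiring

namespace Hemiring

section LatticeOrdered

/-! Each condition is equivalent to: every `a ≠ 0` is sent to `1` by some homomorphism `R → B`
(`BooleanHomsSeparateZero`). Since products lie below both factors, the elements below a given `x`
form an ideal. In an ideal-simple quotient with identity `e`, which is then the greatest element,
the ideal below any `x ≠ 0` contains `e`, so `x = e`: such a quotient is a copy of `B`
(`exists_hom_boolean`).

For the Brown–McCoy radical one only obtains a homomorphism to `B` on the ideal below `a`;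
`IsIdeal.exists_extension` carries it to all of `R`. -/

/-- The equational part of being lattice-ordered, which passes to subhemirings and quotients:
addition is idempotent and `x * y ≤ x`, `x * y ≤ y` for the order induced by addition. -/
structure IsIncline (R : Type u) [NonUnitalSemiring R] : Prop where
  add_self : ∀ x : R, x + x = x
  mul_add_left : ∀ x y : R, x * y + x = x
  mul_add_right : ∀ x y : R, x * y + y = y

variable {R : Type u} {S : Type v} [NonUnitalSemiring R] [NonUnitalSemiring S]

theorem IsLatticeOrdered.isIncline (h : IsLatticeOrdered R) : IsIncline R := by
  obtain ⟨_, h⟩ := h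
  refine ⟨fun x => ?_, fun x y => ?_, fun x y => ?_⟩
  · rw [(h _ _).1, sup_idem]
  · rw [(h _ _).1, sup_eq_right]
    exact (h x y).2.trans inf_le_left
  · rw [(h _ _).1, sup_eq_right]
    exact (h x y).2.trans inf_le_right

theorem IsIncline.of_surjective (h : IsIncline R) (f : R →ₙ+* S)
    (hf : Function.Surjective f) : IsIncline S := by
  refine ⟨hf.forall.2 fun x => ?_, hf.forall.2 fun x => hf.forall.2 fun y => ?_,
    hf.forall.2 fun x => hf.forall.2 fun y => ?_⟩
  · rw [← map_add, h.add_self]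
  · rw [← map_mul, ← map_add, h.mul_add_left]
  · rw [← map_mul, ← map_add, h.mul_add_right]

theorem IsIncline.subsemiring (h : IsIncline R) (I : NonUnitalSubsemiring R) : IsIncline I :=
  ⟨fun x => Subtype.ext (h.add_self x), fun x y => Subtype.ext (h.mul_add_left x y),
    fun x y => Subtype.ext (h.mul_add_right x y)⟩

/-- The elements below `a` for the order induced by addition. -/
def IsIncline.lowerSet (h : IsIncline R) (a : R) : NonUnitalSubsemiring R where
  carrier := {x | x + a = a}
  add_mem' {x y} hx hy := by
    change x + y + a = a
    rw [add_assoc, show y + a = a from hy, show x + a = a from hx]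
  zero_mem' := zero_add a
  mul_mem' {x y} _ hy := by
    have hy : y + a = a := hy
    change x * y + a = a
    rw [← hy, ← add_assoc, h.mul_add_right]

theorem IsIncline.mem_lowerSet (h : IsIncline R) {a x : R} : x ∈ h.lowerSet a ↔ x + a = a :=
  Iff.rfl

theorem IsIncline.isIdeal_lowerSet (h : IsIncline R) (a : R) : IsIdeal (h.lowerSet a) := by
  intro r x hx
  rw [h.mem_lowerSet] at hx
  constructor
  · rw [h.mem_lowerSet, ← hx, ← add_assoc, h.mul_add_right]
  · rw [h.mem_lowerSet, ← hx, ← add_assoc, h.mul_add_left]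

open Classical in
/-- An ideal-simple incline with identity consists of `0` and the identity only, whence it maps
to the Boolean semifield with zero kernel. -/
theorem IsIncline.exists_hom_boolean (h : IsIncline R) (h1 : HasIdentity R)
    (hs : IsIdealSimple R) :
    ∃ f : R →ₙ+* BooleanSemifield, ∀ x, f x = 0 → x = 0 := by
  obtain ⟨e, he⟩ := h1
  -- The identity is the greatest element, because `x = e * x ≤ e`.
  have le_e (x : R) : x + e = e := by simpa [(he x).1] using h.mul_add_left e x
  have eq_e (x : R) (hx : x ≠ 0) : x = e := by
    have hmem : x ∈ h.lowerSet x := h.add_self x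
    rcases hs _ (h.isIdeal_lowerSet x) with hb | ht
    · rw [hb] at hmem
      exact absurd (NonUnitalSubsemiring.mem_bot.1 hmem) hx
    · have : e ∈ h.lowerSet x := ht ▸ NonUnitalSubsemiring.mem_top e
      rw [h.mem_lowerSet, add_comm, le_e] at this
      exact this.symm
  refine ⟨{ toFun := fun x => if x = 0 then 0 else 1
            map_mul' := fun x y => ?_
            map_zero' := if_pos rfl
            map_add' := fun x y => ?_ }, fun x hx => ?_⟩
  · by_cases hx : x = 0
    · simp only [hx, if_true, zero_mul]
    · by_cases hy : y = 0
      · simp only [hy, if_true, mul_zero]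
      · have : x * y = y := by rw [eq_e x hx, (he y).1]
        rw [this, if_neg hx, if_neg hy, mul_one]
  · by_cases hx : x = 0
    · simp only [hx, if_true, zero_add]
    · by_cases hy : y = 0
      · simp only [hy, if_true, add_zero]
      · have hx' := eq_e x hx
        have hy' := eq_e y hy
        have : x + y = e := by rw [hy', le_e]
        rw [this, if_neg hx, if_neg hy, if_neg (hx' ▸ hx)]
        rfl
  · by_contra hne
    exact one_ne_zero ((if_neg hne).symm.trans hx)

end LatticeOrdered

theorem BooleanSemifield.eq_zero_or_one (b : BooleanSemifield) : b = 0 ∨ b = 1 := by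
  cases b
  · exact Or.inl rfl
  · exact Or.inr rfl

theorem BooleanSemifield.add_one (b : BooleanSemifield) : b + 1 = 1 := by
  cases b <;> rfl

/-! ### Subobjects of the Boolean semifield -/

section IsomorphicToBoolean

variable {S : Type v} [NonUnitalSemiring S]

theorem surjective_of_map_eq_one (f : S →ₙ+* BooleanSemifield) {a : S} (ha : f a = 1) :
    Function.Surjective f := by
  intro b
  rcases b.eq_zero_or_one with rfl | rfl
  · exact ⟨0, map_zero f⟩
  · exact ⟨a, ha⟩

theorem hasIdentity_of_bijective (f : S →ₙ+* BooleanSemifield) (hf : Function.Bijective f) :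
    HasIdentity S := by
  obtain ⟨e, he⟩ := hf.2 1
  exact ⟨e, fun x => ⟨hf.1 (by rw [map_mul, he, one_mul]), hf.1 (by rw [map_mul, he, mul_one])⟩⟩

theorem isIdealSimple_of_injective (f : S →ₙ+* BooleanSemifield) (hf : Function.Injective f) :
    IsIdealSimple S := by
  have map_one (x : S) (hx : x ≠ 0) : f x = 1 :=
    (f x).eq_zero_or_one.resolve_left fun h => hx (hf (h.trans (map_zero f).symm))
  intro I _
  refine or_iff_not_imp_left.2 fun hI => eq_top_iff.2 fun x _ => ?_
  obtain ⟨s, hs, hs0⟩ : ∃ s ∈ I, s ≠ 0 := by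
    by_contra! hc
    exact hI (eq_bot_iff.2 fun s hs => NonUnitalSubsemiring.mem_bot.2 (hc s hs))
  by_cases hx : x = 0
  · exact hx ▸ zero_mem I
  · exact hf ((map_one x hx).trans (map_one s hs0).symm) ▸ hs

theorem isCongruenceSimple_of_injective (f : S →ₙ+* BooleanSemifield)
    (hf : Function.Injective f) : IsCongruenceSimple S := by
  intro c
  refine or_iff_not_imp_left.2 fun hc => ?_
  obtain ⟨x, y, hxy, hne⟩ : ∃ x y, c x y ∧ x ≠ y := by
    by_contra! h
    refine hc (RingCon.ext fun x y => ⟨h x y, ?_⟩)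
    rintro rfl
    exact c.refl x
  -- `B` has two elements, so `z` is one of the identified elements `x` and `y`.
  have cover (z : S) : c z x := by
    by_cases hz : f z = f x
    · exact hf hz ▸ c.refl z
    · have hy : f z = f y := by
        have hne' : f x ≠ f y := hf.ne hne
        rcases (f x).eq_zero_or_one with h1 | h1 <;> rcases (f y).eq_zero_or_one with h2 | h2 <;>
          rcases (f z).eq_zero_or_one with h3 | h3 <;> simp_all
      exact hf hy ▸ c.symm hxy
  exact RingCon.ext fun a b => ⟨fun _ => trivial, fun _ => c.trans (cover a) (c.symm (cover b))⟩

/-- In `B` multiplication is the meet; commutativity and the absorption laws pull back along `f`. -/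
theorem isLatticeOrdered_of_injective (f : S →ₙ+* BooleanSemifield)
    (hf : Function.Injective f) : IsLatticeOrdered S := by
  have add_mul_self (a b : S) : a + a * b = a := hf <| by
    rw [map_add, map_mul]
    cases f a <;> cases f b <;> rfl
  have mul_comm' (a b : S) : a * b = b * a := hf <| by rw [map_mul, map_mul, mul_comm]
  let : Max S := ⟨(· + ·)⟩
  let : Min S := ⟨(· * ·)⟩
  let : Lattice S := Lattice.mk' add_comm add_assoc mul_comm' mul_assoc add_mul_self
    fun a b => hf <| by
      change f (a * (a + b)) = f a
      rw [map_mul, map_add]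
      cases f a <;> cases f b <;> rfl
  exact ⟨this, fun a b => ⟨rfl, le_rfl⟩⟩

end IsomorphicToBoolean

/-! ### Subdirect products and homomorphisms to `B` -/

/-- A family of surjective homomorphisms whose kernels intersect in zero yields a
semiisomorphism onto a subdirect product. -/
theorem SemiisomorphicToSubdirectProduct.of_homs {R : Type u} [NonUnitalSemiring R] {ι : Type v}
    {S : ι → Type w} [∀ i, NonUnitalSemiring (S i)] (g : ∀ i, R →ₙ+* S i)
    (hg : ∀ i, Function.Surjective (g i)) (h0 : ∀ a, (∀ i, g i a = 0) → a = 0) :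
    SemiisomorphicToSubdirectProduct R S := by
  let p : R →ₙ+* (∀ i, S i) :=
    { toFun := fun a i => g i a
      map_zero' := funext fun i => map_zero (g i)
      map_add' := fun a b => funext fun i => map_add (g i) a b
      map_mul' := fun a b => funext fun i => map_mul (g i) a b }
  refine ⟨NonUnitalRingHom.srange p, fun i s => ?_, NonUnitalRingHom.srangeRestrict p,
    NonUnitalRingHom.srangeRestrict_surjective p, ?_⟩
  · obtain ⟨a, rfl⟩ := hg i s
    exact ⟨⟨p a, a, rfl⟩, rfl⟩
  · refine Set.eq_singleton_iff_unique_mem.2 ⟨map_zero _, fun a ha => h0 a fun i => ?_⟩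
    exact congrFun (congrArg Subtype.val ha) i

theorem SemiisomorphicToSubdirectProduct.exists_hom_ne_zero {R : Type u} [NonUnitalSemiring R]
    {ι : Type v} {S : ι → Type w} [∀ i, NonUnitalSemiring (S i)]
    (h : SemiisomorphicToSubdirectProduct R S) {a : R} (ha : a ≠ 0) :
    ∃ i, ∃ g : R →ₙ+* S i, g a ≠ 0 := by
  obtain ⟨T, -, f, -, hf0⟩ := h
  by_contra! hc
  have hfa : f a ≠ 0 := fun h0 => ha (hf0.subset h0)
  refine hfa (Subtype.ext (funext fun i => ?_))
  exact hc i
    { toFun := fun x => (f x : ∀ i, S i) i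
      map_zero' := by rw [map_zero]; rfl
      map_add' := fun x y => by rw [map_add]; rfl
      map_mul' := fun x y => by rw [map_mul]; rfl }

/-- The nonzero elements are detected by homomorphisms to the Boolean semifield. -/
def BooleanHomsSeparateZero (R : Type u) [NonUnitalSemiring R] : Prop :=
  ∀ a : R, a ≠ 0 → ∃ g : R →ₙ+* BooleanSemifield, g a = 1

/-- A homomorphism from an ideal `I` to the Boolean semifield with value `1` at `u ∈ I` extends
to the whole hemiring by `x ↦ f (u * x)`. -/
theorem IsIdeal.exists_extension {R : Type u} [NonUnitalSemiring R] {I : NonUnitalSubsemiring R}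
    (hI : IsIdeal I) (f : I →ₙ+* BooleanSemifield) (u : I) (hu : f u = 1) :
    ∃ g : R →ₙ+* BooleanSemifield, ∀ x : I, g x = f x := by
  let l (x : R) : I := ⟨u * x, (hI x u u.2).2⟩
  let r (x : R) : I := ⟨x * u, (hI x u u.2).1⟩
  -- Apply `f` to `u(xu) = (ux)u`: as `f u = 1`, multiplying by `u` on either side gives the same
  -- value.
  have hlr (x : R) : f (r x) = f (l x) := by
    have : u * r x = l x * u := Subtype.ext (mul_assoc (u : R) x u).symm
    have := congrArg f this
    rwa [map_mul, map_mul, hu, one_mul, mul_one] at this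
  refine ⟨{ toFun := fun x => f (l x)
            map_mul' := fun x y => ?_
            map_zero' := ?_
            map_add' := fun x y => ?_ }, fun x => ?_⟩
  -- The extra `u` on the right splits `u(xy)u` into the elements `ux` and `yu` of `I`.
  · have : l (x * y) * u = l x * r y := Subtype.ext (by simp only [l, r, MulMemClass.mk_mul_mk,
      NonUnitalSubsemiring.coe_mul, mul_assoc])
    have := congrArg f this
    rwa [map_mul, map_mul, hu, mul_one, hlr] at this
  · rw [show l 0 = 0 from Subtype.ext (mul_zero (u : R)), map_zero]
  · rw [← map_add, show l (x + y) = l x + l y from Subtype.ext (mul_add (u : R) x y)]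
  · change f (l x) = f x
    rw [show l x = u * x from rfl, map_mul, hu, one_mul]

/-! ### The four conditions and separation by homomorphisms to `B` -/

section Equivalences

variable {R : Type u} [NonUnitalSemiring R]

/-- The ideal below `a` contains `a ≠ 0`, so it is not radical and maps to `B` with value `1` at
some `u ≤ a`. After extension to `R`, monotonicity forces value `1` at `a`. -/
theorem IsIncline.separate_of_brownMcCoyRadical (h : IsIncline R)
    (hR : brownMcCoyRadical R = {0}) : BooleanHomsSeparateZero R := by
  intro a ha
  have hI := h.isIdeal_lowerSet a
  have hnot : ¬ IsBrownMcCoyRadical (h.lowerSet a) := fun hrad =>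
    ha (hR.subset (Set.mem_biUnion (show h.lowerSet a ∈ {I | IsIdeal I ∧ IsBrownMcCoyRadical I}
      from ⟨hI, hrad⟩) (h.add_self a)))
  simp only [IsBrownMcCoyRadical, not_forall, not_not] at hnot
  obtain ⟨S, _, _, f, hf, h1, hs⟩ := hnot
  obtain ⟨k, hk⟩ := ((h.subsemiring _).of_surjective f hf).exists_hom_boolean h1 hs
  obtain ⟨s, hs0⟩ := exists_ne (0 : S)
  obtain ⟨u, rfl⟩ := hf s
  have hu : k.comp f u = 1 := (k (f u)).eq_zero_or_one.resolve_left fun h0 => hs0 (hk _ h0)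
  obtain ⟨g, hg⟩ := hI.exists_extension (k.comp f) u hu
  refine ⟨g, ?_⟩
  have hua := congrArg g (h.mem_lowerSet.1 u.2)
  rw [map_add, hg u, hu, add_comm, BooleanSemifield.add_one] at hua
  exact hua.symm

/-- If an ideal contains `a` and `g a = 1`, then `g` restricted to it is onto `B`, an ideal-simple
semiring, so the ideal is not radical. -/
theorem BooleanHomsSeparateZero.brownMcCoyRadical_eq (h : BooleanHomsSeparateZero R) :
    brownMcCoyRadical R = {0} := by
  refine Set.eq_singleton_iff_unique_mem.2 ⟨?_, fun a ha => ?_⟩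
  · refine Set.mem_biUnion (x := (⊥ : NonUnitalSubsemiring R)) ⟨?_, ?_⟩ (zero_mem _)
    · intro r a ha
      rw [NonUnitalSubsemiring.mem_bot] at ha
      simp [ha]
    · intro S _ _ f hf
      obtain ⟨s, hs⟩ := exists_ne (0 : S)
      obtain ⟨x, rfl⟩ := hf s
      have : x = 0 := Subtype.ext (NonUnitalSubsemiring.mem_bot.1 x.2)
      exact absurd (this ▸ map_zero f) hs
  · obtain ⟨I, ⟨-, hI⟩, haI⟩ := Set.mem_iUnion₂.1 ha
    by_contra ha0
    obtain ⟨g, hg⟩ := h a ha0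
    -- The radical class tests images in `Type u`, so `B` is lifted to that universe.
    let e : ULift.{u} BooleanSemifield ≃+* BooleanSemifield := ULift.ringEquiv
    let e' : ULift.{u} BooleanSemifield →ₙ+* BooleanSemifield := e
    have he : Function.Bijective e' := e.bijective
    have hs : Function.Surjective (g.comp (NonUnitalSubsemiringClass.subtype I)) :=
      surjective_of_map_eq_one _ (a := ⟨a, haI⟩) hg
    exact hI (ULift.{u} BooleanSemifield)
      ((e.symm : BooleanSemifield →ₙ+* ULift.{u} BooleanSemifield).comp
        (g.comp (NonUnitalSubsemiringClass.subtype I)))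
      (e.symm.surjective.comp hs)
      ⟨hasIdentity_of_bijective e' he, isIdealSimple_of_injective e' he.1⟩

theorem IsIncline.separate_of_simpleCongruenceRadical (h : IsIncline R)
    (hR : simpleCongruenceRadical R = {0}) : BooleanHomsSeparateZero R := by
  intro a ha
  have hnot : a ∉ simpleCongruenceRadical R := fun hmem => ha (hR.subset hmem)
  simp only [simpleCongruenceRadical, Set.mem_iInter, not_forall] at hnot
  obtain ⟨ρ, ⟨-, h1, hs, -⟩, hρ⟩ := hnot
  let q : R →ₙ+* ρ.Quotient :=
    { toFun := fun x => (x : ρ.Quotient)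
      map_zero' := rfl
      map_add' := fun _ _ => rfl
      map_mul' := fun _ _ => rfl }
  have hq : Function.Surjective q := Quotient.mk_surjective
  obtain ⟨k, hk⟩ := (h.of_surjective q hq).exists_hom_boolean h1 hs
  exact ⟨k.comp q, (k (q a)).eq_zero_or_one.resolve_left fun h0 => hρ (ρ.eq.1 (hk _ h0))⟩

theorem BooleanHomsSeparateZero.simpleCongruenceRadical_eq (h : BooleanHomsSeparateZero R) :
    simpleCongruenceRadical R = {0} := by
  refine Set.eq_singleton_iff_unique_mem.2 ⟨Set.mem_iInter₂.2 fun ρ _ => ρ.refl 0, fun a ha => ?_⟩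
  by_contra ha0
  obtain ⟨g, hg⟩ := h a ha0
  -- The kernel congruence of `g`: its quotient is a copy of `B`, and it does not relate `a` to `0`.
  let ρ : RingCon R :=
    { r := fun x y => g x = g y
      iseqv := ⟨fun _ => rfl, Eq.symm, Eq.trans⟩
      add' := fun h1 h2 => by rw [map_add, map_add, h1, h2]
      mul' := fun h1 h2 => by rw [map_mul, map_mul, h1, h2] }
  let k : ρ.Quotient →ₙ+* BooleanSemifield :=
    { toFun := Quotient.lift g fun _ _ h => h
      map_zero' := map_zero g
      map_add' := by rintro ⟨x⟩ ⟨y⟩; exact map_add g x y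
      map_mul' := by rintro ⟨x⟩ ⟨y⟩; exact map_mul g x y }
  have hinj : Function.Injective k := by
    rintro ⟨x⟩ ⟨y⟩ hxy
    exact Quotient.sound hxy
  have hsurj : Function.Surjective k := surjective_of_map_eq_one k (a := (a : ρ.Quotient)) hg
  have hρ : ρ ∈ simpleCongruences R := ⟨hsurj.nontrivial,
    hasIdentity_of_bijective k ⟨hinj, hsurj⟩, isIdealSimple_of_injective k hinj,
    isCongruenceSimple_of_injective k hinj⟩
  have : g a = g 0 := Set.mem_iInter₂.1 ha ρ hρ
  rw [hg, map_zero] at this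
  exact one_ne_zero this

theorem BooleanHomsSeparateZero.semiisomorphic (h : BooleanHomsSeparateZero R) :
    ∃ ι : Type u, SemiisomorphicToSubdirectProduct R (fun _ : ι => BooleanSemifield) := by
  choose g hg using h
  -- One factor for each nonzero element, whose own coordinate is then `1`.
  refine ⟨{a : R // a ≠ 0}, .of_homs (fun a => g a a.2)
    (fun a => surjective_of_map_eq_one _ (hg a a.2)) fun a ha => ?_⟩
  by_contra ha0
  exact one_ne_zero ((hg a ha0).symm.trans (ha ⟨a, ha0⟩))

theorem BooleanHomsSeparateZero.semiisomorphic_simple (h : BooleanHomsSeparateZero R) :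
    ∃ (ι : Type u) (S : ι → Type u) (_ : ∀ i, NonUnitalSemiring (S i)),
      (∀ i, Nontrivial (S i) ∧ HasIdentity (S i) ∧ IsLatticeOrdered (S i) ∧ IsSimple (S i)) ∧
      SemiisomorphicToSubdirectProduct R S := by
  let e : ULift.{u} BooleanSemifield ≃+* BooleanSemifield := ULift.ringEquiv
  let e' : ULift.{u} BooleanSemifield →ₙ+* BooleanSemifield := e
  have he : Function.Bijective e' := e.bijective
  choose g hg using h
  refine ⟨{a : R // a ≠ 0}, fun _ => ULift.{u} BooleanSemifield, fun _ => inferInstance,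
    fun _ => ⟨he.2.nontrivial, hasIdentity_of_bijective e' he,
      isLatticeOrdered_of_injective e' he.1, isIdealSimple_of_injective e' he.1,
      isCongruenceSimple_of_injective e' he.1⟩,
    .of_homs (fun a => (e.symm : BooleanSemifield →ₙ+* ULift.{u} BooleanSemifield).comp (g a a.2))
    (fun a => e.symm.surjective.comp (surjective_of_map_eq_one _ (hg a a.2))) fun a ha => ?_⟩
  by_contra ha0
  have : g a ha0 a = 0 := e.symm.injective ((ha ⟨a, ha0⟩).trans (map_zero e.symm).symm)
  exact one_ne_zero ((hg a ha0).symm.trans this)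

end Equivalences

end Hemiring

theorem corollary3p17 (R : Type u) [NonUnitalSemiring R] (hR : Hemiring.IsLatticeOrdered R) :
    List.TFAE [
      Hemiring.brownMcCoyRadical R = {0},
      Hemiring.simpleCongruenceRadical R = {0},
      ∃ (ι : Type u) (S : ι → Type u) (_ : ∀ i, NonUnitalSemiring (S i)),
        (∀ i, Nontrivial (S i) ∧ Hemiring.HasIdentity (S i) ∧
          Hemiring.IsLatticeOrdered (S i) ∧ Hemiring.IsSimple (S i)) ∧
        Hemiring.SemiisomorphicToSubdirectProduct R S,
      ∃ ι : Type u,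
        Hemiring.SemiisomorphicToSubdirectProduct R (fun _ : ι => Hemiring.BooleanSemifield)] := by
  have h := hR.isIncline
  tfae_have 1 → 2 := fun h1 =>
    (h.separate_of_brownMcCoyRadical h1).simpleCongruenceRadical_eq
  tfae_have 2 → 3 := fun h2 => (h.separate_of_simpleCongruenceRadical h2).semiisomorphic_simple
  tfae_have 3 → 4 := by
    rintro ⟨ι, S, _, hS, hsub⟩
    refine Hemiring.BooleanHomsSeparateZero.semiisomorphic fun a ha => ?_
    obtain ⟨i, g, hg⟩ := hsub.exists_hom_ne_zero ha
    obtain ⟨-, h1, hlat, hs, -⟩ := hS i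
    obtain ⟨k, hk⟩ := hlat.isIncline.exists_hom_boolean h1 hs
    exact ⟨k.comp g, (k (g a)).eq_zero_or_one.resolve_left fun h0 => hg (hk _ h0)⟩
  tfae_have 4 → 1 := by
    rintro ⟨ι, hsub⟩
    refine Hemiring.BooleanHomsSeparateZero.brownMcCoyRadical_eq fun a ha => ?_
    obtain ⟨_, g, hg⟩ := hsub.exists_hom_ne_zero ha
    exact ⟨g, (g a).eq_zero_or_one.resolve_left hg⟩
  tfae_finish
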